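/- Conventions. A graph is a simple undirected graph $G$ (finite or infinite) with vertex set $V(G)$. For $A,B\subseteq V(G)$, the $(A,B)$-flip of $G$ is the graph on $V(G)$ with edge set $E(G)\,\triangle\,\{ab : a\in A,\ b\in B,\ a\neq b\}$. For a partition $\mathcal P$ of $V(G)$ into nonempty parts, a $\mathcal P$-flip of $G$ is any graph obtained from $G$ by a finite (possibly empty) sequence of flips, each of which is an $(A,B)$-flip for some, possibly equal, $A,B\in\mathcal P$. For vertices $u,v$ let $\mathrm{dist}_{\mathcal P}(u,v)\in\mathbb N\cup\{\infty\}$ be the maximum of the shortest-path distances $\mathrm{dist}_{G'}(u,v)$ over all $\mathcal P$-flips $G'$ of $G$, and for tuples $\bar u,\bar v$ let $\mathrm{dist}_{\mathcal P}(\bar u,\bar v)$ be the minimum of $\mathrm{dist}_{\mathcal P}(a,b)$ over all entries $a$ of $\bar u$ and $b$ of $\bar v$ ($\infty$ if one of the tuples is empty). The quantifier rank $\mathrm{qr}(\varphi)$ is the maximum number of nested quantifiers in $\varphi$, and $[\ell]=\{1,\dots,\ell\}$. Lemma. There are functions $\rho:\mathbb N\to\mathbb N$ and $\ell:\mathbb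 N^4\to\mathbb N$ such that the following holds for every $p\in\mathbb N$ and every first-order formula $\varphi(\bar x,\bar y)$ in the language of graphs (adjacency and equality). Put $\rho=\rho(\mathrm{qr}(\varphi))$ and $\ell=\ell(\mathrm{qr}(\varphi),|\bar x|,|\bar y|,p)$. For every graph $G$ and every partition $\mathcal P$ of $V(G)$ with at most $p$ parts there are colorings $\mathrm{col}_1:V(G)^{\bar x}\to[\ell]$ and $\mathrm{col}_2:V(G)^{\bar y}\to[\ell]$ such that, for tuples $\bar u\in V(G)^{\bar x}$ and $\bar v\in V(G)^{\bar y}$ with $\mathrm{dist}_{\mathcal P}(\bar u,\bar v)>\rho$, whether $\varphi(\bar u,\bar v)$ holds in $G$ depends only on $\mathrm{col}_1(\bar u)$ and $\mathrm{col}_2(\bar v)$; that is, if $\mathrm{dist}_{\mathcal P}(\bar u,\bar v)>\rho$, $\mathrm{dist}_{\mathcal P}(\bar u',\bar v')>\rho$, $\mathrm{col}_1(\bar u)=\mathrm{col}_1(\bar u')$ and $\mathrm{col}_2(\bar v)=\mathrm{col}_2(\bar v')$, then $G\models\varphi(\bar u,\bar v)\iff G\models\varphi(\bar u',\bar v')$.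 -/

import Mathlib

open FirstOrder

namespace FirstOrder.Language.BoundedFormula

/-- The quantifier rank of a first-order formula: the maximum number of nested quantifiers.
(The primitive connectives are `⊥`, `⟹` and `∀`; the others, `∃` included, are abbreviations.) -/
def quantifierRank {L : Language} {α : Type*} : {n : ℕ} → L.BoundedFormula α n → ℕ
  | _, .falsum => 0
  | _, .equal _ _ => 0
  | _, .rel _ _ => 0
  | _, .imp φ ψ => max φ.quantifierRank ψ.quantifierRank
  | _, .all φ => φ.quantifierRank + 1

end FirstOrder.Language.BoundedFormula

namespace SimpleGraph

variable {V : Type*}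

/-- The `(A, B)`-flip of `G`: the graph on the same vertices whose edge set is
`E(G) ∆ {ab : a ∈ A, b ∈ B, a ≠ b}`. -/
def flip (G : SimpleGraph V) (A B : Set V) : SimpleGraph V :=
  symmDiff G (SimpleGraph.fromRel fun a b => a ∈ A ∧ b ∈ B)

/-- `G.IsPartitionFlip P G'`: the graph `G'` is a `P`-flip of `G`, that is, `G'` is obtained from
`G` by a finite sequence of flips, each of which is an `(A, B)`-flip for some (possibly equal)
parts `A, B ∈ P`. -/
inductive IsPartitionFlip (G : SimpleGraph V) (P : Set (Set V)) : SimpleGraph V → Prop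
  | refl : IsPartitionFlip G P G
  | step {G' : SimpleGraph V} {A B : Set V} (h : IsPartitionFlip G P G') (hA : A ∈ P)
      (hB : B ∈ P) : IsPartitionFlip G P (G'.flip A B)

/-- The partition metric `dist_P(u, v)`: the maximum, over all `P`-flips `G'` of `G`, of the
shortest-path distance of `u` and `v` in `G'` (which is `⊤` if `G'` has no path from `u` to `v`). -/
noncomputable def partitionDist (G : SimpleGraph V) (P : Set (Set V)) (u v : V) : ℕ∞ :=
  ⨆ (G' : SimpleGraph V) (_ : G.IsPartitionFlip P G'), G'.edist u v

/-- The `P`-distance of two tuples: the minimum of `dist_P(a, b)` over the entries `a` of the first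
and `b` of the second tuple (`⊤` if one of the tuples is empty). -/
noncomputable def partitionTupleDist (G : SimpleGraph V) (P : Set (Set V)) {m n : ℕ}
    (u : Fin m → V) (v : Fin n → V) : ℕ∞ :=
  ⨅ (i : Fin m) (j : Fin n), G.partitionDist P (u i) (v j)

/-- `G ⊨ φ(ū, v̄)`, for a first-order formula `φ(x̄, ȳ)` in the language of graphs. -/
def Satisfies (G : SimpleGraph V) {m n : ℕ} (φ : Language.graph.Formula (Fin m ⊕ Fin n))
    (u : Fin m → V) (v : Fin n → V) : Prop :=
  letI : Language.graph.Structure V := G.structure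
  φ.Realize (Sum.elim u v)

end SimpleGraph

/-!
The proof has two independent steps, one about flips and one about games.

*Adjacency* (`SimpleGraph.exists_determinesFarAdj`). Some colouring of the vertices, with a number of
colours depending only on `p`, determines the adjacency of any two vertices at partition distance
more than `5`. Call a part of `P` large if three of its vertices are pairwise at distance more than
`2` in one and the same flip. By Ramsey's theorem for triangles, a part that is not large is covered
by boundedly many balls of radius `2` in the partition metric. Such a ball is small in every flip, so
a single flip separating its centre `w` from `v` separates all of the ball from `v` and decides all
adjacencies between the ball and `v`; the colour of `v` stores which pairs of parts are complemented
in that flip. Between two large parts, the adjacency of all far pairs is the same: otherwise each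
flip would join an exceptional far pair by a path of length `3` through the two triples.

*Games* (`SimpleGraph.exists_determinesBackForth`). From here on, only the triangle inequality and
the colouring above are used. Tuples are divided into blocks that are far from each other, and by
induction on `q` the blocks are coloured so that these colours determine the `q`-round
Ehrenfeucht–Fraïssé type of the whole tuple. One more round multiplies the required distance by `6`,
regardless of the number of variables and of colours. Working with arbitrarily many blocks allows a
new vertex that is far from all blocks to form a block of its own.
-/

/-! ### Extended distances -/

/-- `D` is an extended pseudometric with values in `ℕ∞`. -/
structure IsExtDist {V : Type*} (D : V → V → ℕ∞) : Prop where
  self : ∀ a, D a a = 0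
  symm : ∀ a b, D a b = D b a
  triangle : ∀ a b c, D a c ≤ D a b + D b c

namespace IsExtDist

variable {V : Type*} {D : V → V → ℕ∞}

theorem lt_right (hD : IsExtDist D) {a b c : V} {r s : ℕ} (h : ((r + s : ℕ) : ℕ∞) < D a c)
    (hab : D a b ≤ r) : (s : ℕ∞) < D b c := by
  by_contra! hbc
  refine absurd h (not_lt.2 ((hD.triangle a b c).trans ?_))
  push_cast
  exact add_le_add hab hbc

theorem ne_of_lt (hD : IsExtDist D) {a b : V} {r : ℕ} (h : (r : ℕ∞) < D a b) : a ≠ b := by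
  rintro rfl
  simp [hD.self] at h

/-- Among more than `|ι|` points at pairwise distance more than `2r`, one has distance more than
`r` from every member of a given `ι`-indexed family: a member is `r`-close to at most one point. -/
theorem exists_far (hD : IsExtDist D) {ι : Type*} [Fintype ι] {N : ℕ} (hN : Fintype.card ι < N)
    {r : ℕ} {w : Fin N → V} (hw : ∀ i j, i < j → ((r + r : ℕ) : ℕ∞) < D (w i) (w j))
    (u : ι → V) : ∃ k, ∀ i, (r : ℕ∞) < D (u i) (w k) := by
  by_contra! h
  choose i hi using h
  obtain ⟨k, l, hkl, h⟩ := Fintype.exists_ne_map_eq_of_card_lt i (by simpa using hN)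
  have key : ∀ k l, k < l → i k = i l → False := fun k l hkl h => by
    have h1 := hD.lt_right (hw k l hkl) (by rw [hD.symm]; exact hi k)
    rw [h] at h1
    exact absurd h1 (not_lt.2 (hi l))
  rcases lt_or_gt_of_ne hkl with h' | h'
  · exact key k l h' h
  · exact key l k h' h.symm

end IsExtDist

/-- A set either contains `N` points that are pairwise related by `R`, or has `N` centres such that
each of its points fails to be `R`-related to one of them. -/
theorem exists_pairwise_or_cover {V : Type*} [Nonempty V] (R : V → V → Prop) (S : Set V) (N : ℕ) :
    (∃ w : Fin N → V, (∀ i, w i ∈ S) ∧ ∀ i j, i < j → R (w i) (w j)) ∨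
      ∃ w : Fin N → V, ∀ u ∈ S, ∃ i, ¬ R (w i) u := by
  induction N with
  | zero => exact .inl ⟨finZeroElim, fun i => i.elim0, fun i => i.elim0⟩
  | succ N ih =>
    have extend : ∀ w : Fin N → V, (∀ u ∈ S, ∃ i, ¬ R (w i) u) →
        ∃ w : Fin (N + 1) → V, ∀ u ∈ S, ∃ i, ¬ R (w i) u := fun w hw => by
      refine ⟨Fin.snoc w (Classical.arbitrary V), fun u hu => ?_⟩
      obtain ⟨i, hi⟩ := hw u hu
      exact ⟨i.castSucc, by simpa using hi⟩
    rcases ih with ⟨w, hwS, hw⟩ | ⟨w, hw⟩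
    · by_cases h : ∀ u ∈ S, ∃ i, ¬ R (w i) u
      · exact .inr (extend w h)
      · push Not at h
        obtain ⟨u, hu, h⟩ := h
        refine .inl ⟨Fin.snoc w u, fun i => ?_, fun i j hij => ?_⟩
        · induction i using Fin.lastCases <;> simp [hu, hwS]
        · induction j using Fin.lastCases with
          | last =>
            induction i using Fin.lastCases with
            | last => exact absurd hij (lt_irrefl _)
            | cast i => simpa using h i
          | cast j =>
            induction i using Fin.lastCases with
            | last => exact absurd hij (not_lt.2 (Fin.le_last _))
            | cast i => simpa using hw i j (by simpa using hij)
    · exact .inr (extend w hw)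

/-! ### Monochromatic triangles -/

/-- Ramsey's theorem for triangles and finitely many colours. -/
theorem exists_monochromatic_triangle (C : Type*) [Finite C] :
    ∃ N : ℕ, ∀ col : Fin N → Fin N → C,
      ∃ i j k, i < j ∧ j < k ∧ col i j = col i k ∧ col i j = col j k := by
  classical
  have key : ∀ m : ℕ, ∃ N : ℕ, ∀ (M : ℕ) (col : Fin M → Fin M → C) (S : Finset (Fin M))
      (T : Finset C), N ≤ S.card → T.card ≤ m → (∀ i ∈ S, ∀ j ∈ S, i < j → col i j ∈ T) →
      ∃ i j k, i < j ∧ j < k ∧ col i j = col i k ∧ col i j = col j k := by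
    intro m
    induction m with
    | zero =>
      refine ⟨2, fun M col S T hS hT h => ?_⟩
      obtain ⟨i, hi, j, hj, hij⟩ := Finset.one_lt_card.1 hS
      rw [Finset.card_eq_zero.1 (Nat.le_zero.1 hT)] at h
      rcases lt_or_gt_of_ne hij with h' | h'
      · exact absurd (h i hi j hj h') (by simp)
      · exact absurd (h j hj i hi h') (by simp)
    | succ m ih =>
      obtain ⟨N, hN⟩ := ih
      refine ⟨(m + 1) * N + 2, fun M col S T hS hT h => ?_⟩
      have hne : S.Nonempty := Finset.card_pos.1 (by omega)
      -- The edges leaving the least vertex `s` give many vertices `F` joined to `s` in one colour.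
      let s := S.min' hne
      have hs : s ∈ S := S.min'_mem hne
      have hlt : ∀ j ∈ S.erase s, s < j := fun j hj => S.min'_lt_of_mem_erase_min' hne hj
      have hcard : (S.erase s).card = S.card - 1 := Finset.card_erase_of_mem hs
      obtain ⟨c, hc, hF⟩ := Finset.exists_lt_card_fiber_of_mul_lt_card_of_maps_to
        (s := S.erase s) (t := T) (f := fun j => col s j) (n := N)
        (fun j hj => h s hs j (Finset.mem_of_mem_erase hj) (hlt j hj))
        (by have := Nat.mul_le_mul_right N hT; omega)
      by_cases htri : ∃ i ∈ (S.erase s).filter (fun j => col s j = c),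
          ∃ j ∈ (S.erase s).filter (fun j => col s j = c), i < j ∧ col i j = c
      · obtain ⟨i, hi, j, hj, hij, hc⟩ := htri
        rw [Finset.mem_filter] at hi hj
        exact ⟨s, i, j, hlt i hi.1, hij, hi.2.trans hj.2.symm, hi.2.trans hc.symm⟩
      · push Not at htri
        refine hN M col _ (T.erase c) hF.le
          (by rw [Finset.card_erase_of_mem hc]; omega) fun i hi j hj hij => ?_
        refine Finset.mem_erase.2 ⟨htri i hi j hj hij, ?_⟩
        rw [Finset.mem_filter] at hi hj
        exact h i (Finset.mem_of_mem_erase hi.1) j (Finset.mem_of_mem_erase hj.1) hij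
  have := Fintype.ofFinite C
  obtain ⟨N, hN⟩ := key (Fintype.card C)
  exact ⟨N, fun col => hN N col Finset.univ Finset.univ (by simp) (by simp)
    fun _ _ _ _ _ => Finset.mem_univ _⟩

namespace SimpleGraph

/-! ### Back-and-forth equivalence -/

/-- Equivalence of two tuples of vertices in the `q`-round Ehrenfeucht–Fraïssé game played on a
single graph. -/
def BackForth {V : Type*} (G : SimpleGraph V) : ℕ → ∀ {ι : Type}, (ι → V) → (ι → V) → Prop
  | 0, _, u, u' => ∀ i j, (u i = u j ↔ u' i = u' j) ∧ (G.Adj (u i) (u j) ↔ G.Adj (u' i) (u' j))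
  | q + 1, _, u, u' =>
    (∀ z, ∃ z', G.BackForth q (Option.elim' z u) (Option.elim' z' u')) ∧
      ∀ z', ∃ z, G.BackForth q (Option.elim' z u) (Option.elim' z' u')

namespace BackForth

variable {V : Type*} {G : SimpleGraph V} {q : ℕ}

theorem comp {ι κ : Type} {u u' : ι → V} (h : G.BackForth q u u') (f : κ → ι) :
    G.BackForth q (u ∘ f) (u' ∘ f) := by
  induction q generalizing ι κ with
  | zero => exact fun i j => h (f i) (f j)
  | succ q ih =>
    have key : ∀ z (u : ι → V),
        (Option.elim' z (u ∘ f) : Option κ → V) = Option.elim' z u ∘ Option.map f :=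
      fun z u => funext fun o => by cases o <;> rfl
    refine ⟨fun z => ?_, fun z' => ?_⟩
    · obtain ⟨z', h'⟩ := h.1 z
      exact ⟨z', by rw [key, key]; exact ih h' _⟩
    · obtain ⟨z, h'⟩ := h.2 z'
      exact ⟨z, by rw [key, key]; exact ih h' _⟩

theorem zero [Nonempty V] {ι : Type} {u u' : ι → V} (h : G.BackForth q u u') :
    G.BackForth 0 u u' := by
  induction q generalizing ι with
  | zero => exact h
  | succ q ih =>
    obtain ⟨z', h'⟩ := h.1 (Classical.arbitrary V)
    exact (ih h').comp some

/-- Formulas of quantifier rank at most `q` do not distinguish tuples that are equivalent in the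
`q`-round game. -/
theorem realize_iff [Nonempty V] {α : Type} {k : ℕ} (φ : Language.graph.BoundedFormula α k)
    {v v' : α → V} {xs xs' : Fin k → V} (hq : φ.quantifierRank ≤ q)
    (h : G.BackForth q (Sum.elim v xs) (Sum.elim v' xs')) :
    letI := G.structure
    φ.Realize v xs ↔ φ.Realize v' xs' := by
  let := G.structure
  have term : ∀ {k : ℕ} (t : Language.graph.Term (α ⊕ Fin k)), ∃ x, t = .var x := fun t => by
    cases t with
    | var x => exact ⟨x, rfl⟩
    | func f _ => exact isEmptyElim f
  induction φ generalizing q with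
  | falsum => exact Iff.rfl
  | equal t₁ t₂ =>
    obtain ⟨x, rfl⟩ := term t₁
    obtain ⟨y, rfl⟩ := term t₂
    exact (h.zero x y).1
  | rel R ts =>
    cases R
    obtain ⟨x, hx⟩ := term (ts 0)
    obtain ⟨y, hy⟩ := term (ts 1)
    have := (h.zero x y).2
    change G.Adj ((ts 0).realize _) ((ts 1).realize _) ↔
      G.Adj ((ts 0).realize _) ((ts 1).realize _)
    rw [hx, hy]
    exact this
  | imp φ ψ ihφ ihψ =>
    have hq := max_le_iff.1 hq
    exact imp_congr (ihφ hq.1 h) (ihψ hq.2 h)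
  | @all k φ ih =>
    obtain _ | q := q
    · exact absurd hq (by simp [Language.BoundedFormula.quantifierRank])
    have hq : φ.quantifierRank ≤ q := Nat.succ_le_succ_iff.1 hq
    -- The new variable, the last of `k + 1`, is the point `none` of the extended index type.
    let f : α ⊕ Fin (k + 1) → Option (α ⊕ Fin k) :=
      Sum.elim (fun a => some (.inl a)) (Fin.snoc (fun i => some (.inr i)) none)
    have key : ∀ z (v : α → V) (xs : Fin k → V),
        Option.elim' z (Sum.elim v xs) ∘ f = Sum.elim v (Fin.snoc xs z) := fun z v xs => by
      funext x
      rcases x with a | i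
      · rfl
      · induction i using Fin.lastCases <;> simp [f]
    have step : ∀ z z', G.BackForth q (Option.elim' z (Sum.elim v xs))
        (Option.elim' z' (Sum.elim v' xs')) →
        (φ.Realize v (Fin.snoc xs z) ↔ φ.Realize v' (Fin.snoc xs' z')) := fun z z' h' =>
      ih hq (by rw [← key, ← key]; exact h'.comp f)
    refine ⟨fun H z' => ?_, fun H z => ?_⟩
    · obtain ⟨z, h'⟩ := h.2 z'
      exact (step z z' h').1 (H z)
    · obtain ⟨z', h'⟩ := h.1 z
      exact (step z z' h').2 (H z')

theorem symm {ι : Type} {u u' : ι → V} (h : G.BackForth q u u') : G.BackForth q u' u := by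
  induction q generalizing ι with
  | zero => exact fun i j => ⟨(h i j).1.symm, (h i j).2.symm⟩
  | succ q ih => exact ⟨fun z => (h.2 z).imp fun _ => ih, fun z => (h.1 z).imp fun _ => ih⟩

end BackForth

/-! ### Colouring blocks of a tuple -/

/-- The part of the tuple `u` formed by the entries whose index lies in the block `b` of `κ`,
encoded as a partial tuple on the whole index type. -/
noncomputable def restrictBlock {V ι β : Type*} (κ : ι → β) (b : β) (u : ι → V) : ι → Option V :=
  open Classical in fun i => if κ i = b then some (u i) else none

section restrictBlock

variable {V ι β : Type*} {κ : ι → β} {b : β} {u : ι → V}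

theorem restrictBlock_eq_some {i : ι} {a : V} :
    restrictBlock κ b u i = some a ↔ κ i = b ∧ u i = a := by
  unfold restrictBlock
  split_ifs <;> simp_all

theorem restrictBlock_of_eq {i : ι} (h : κ i = b) : restrictBlock κ b u i = some (u i) :=
  if_pos h

theorem restrictBlock_elim'_same (z : V) :
    restrictBlock (Option.elim' b κ) b (Option.elim' z u) =
      Option.elim' (some z) (restrictBlock κ b u) := by
  ext o a
  cases o <;> simp [restrictBlock_eq_some]

theorem restrictBlock_elim'_ne {b' : β} (h : b' ≠ b) (z : V) :
    restrictBlock (Option.elim' b' κ) b (Option.elim' z u) =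
      Option.elim' none (restrictBlock κ b u) := by
  ext o a
  cases o <;> simp [restrictBlock_eq_some, h]

theorem restrictBlock_new_none (z : V) :
    restrictBlock (Option.elim' none (some ∘ κ)) none (Option.elim' z u) =
      Option.elim' (some z) fun _ => none := by
  ext o a
  cases o <;> simp [restrictBlock_eq_some]

theorem restrictBlock_new_some (z : V) :
    restrictBlock (Option.elim' none (some ∘ κ)) (some b) (Option.elim' z u) =
      Option.elim' none (restrictBlock κ b u) := by
  ext o a
  cases o <;> simp [restrictBlock_eq_some]

end restrictBlock

/-- Entries of `u` lying in different blocks of `κ` have `D`-distance more than `r`. -/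
def Separated {V ι β : Type*} (D : V → V → ℕ∞) (r : ℕ) (κ : ι → β) (u : ι → V) : Prop :=
  ∀ i j, κ i ≠ κ j → (r : ℕ∞) < D (u i) (u j)

theorem Separated.elim' {V ι β : Type*} {D : V → V → ℕ∞} (hD : IsExtDist D) {r s : ℕ} {κ : ι → β}
    {u : ι → V} (h : Separated D s κ u) (hrs : r ≤ s) {b : β} {z : V}
    (hz : ∀ i, κ i ≠ b → (r : ℕ∞) < D (u i) z) :
    Separated D r (Option.elim' b κ) (Option.elim' z u) := by
  rintro (_ | i) (_ | j) hij
  · exact absurd rfl hij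
  · change _ < D z (u j)
    rw [hD.symm]
    exact hz j (Ne.symm hij)
  · exact hz i hij
  · exact lt_of_le_of_lt (by exact_mod_cast hrs) (h i j hij)

/-- `col` assigns colours to partial tuples in such a way that the `q`-round game cannot
distinguish two `r`-separated tuples whose blocks have equal colours. -/
def DeterminesBackForth {V K : Type*} (G : SimpleGraph V) (D : V → V → ℕ∞) (q r : ℕ)
    {ι : Type} (col : (ι → Option V) → K) : Prop :=
  ∀ (β : Type) (κ : ι → β) (u u' : ι → V), Separated D r κ u → Separated D r κ u' →
    (∀ b, col (restrictBlock κ b u) = col (restrictBlock κ b u')) → G.BackForth q u u'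

/-- Adjacency of vertices at `D`-distance more than `r` depends only on their colours. -/
def DeterminesFarAdj {V C : Type*} (G : SimpleGraph V) (D : V → V → ℕ∞) (r : ℕ) (c : V → C) :
    Prop :=
  ∀ u u' v v', (r : ℕ∞) < D u v → (r : ℕ∞) < D u' v' → c u = c u' → c v = c v' →
    (G.Adj u v ↔ G.Adj u' v')

/-- For atomic formulas, a block is coloured by its atomic type and the colours of its entries. -/
theorem exists_determinesBackForth_zero (ι C : Type) [Finite ι] [Finite C] :
    ∃ (K : Type) (_ : Finite K), ∀ (V : Type*) (G : SimpleGraph V) (D : V → V → ℕ∞) (r : ℕ)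
      (c : V → C), IsExtDist D → G.DeterminesFarAdj D r c →
      ∃ col : (ι → Option V) → K, G.DeterminesBackForth D 0 r col := by
  refine ⟨(ι → ι → Prop) × (ι → ι → Prop) × (ι → Option C), inferInstance,
    fun V G D r c hD hc => ⟨fun s => (fun i j => s i = s j,
      fun i j => ∃ a b, s i = some a ∧ s j = some b ∧ G.Adj a b, fun i => (s i).map c), ?_⟩⟩
  intro β κ u u' hu hu' hcol i j
  simp only [Prod.mk.injEq] at hcol
  by_cases hij : κ j = κ i
  · obtain ⟨h1, h2, -⟩ := hcol (κ i)
    have h1 := congrFun₂ h1 i j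
    have h2 := congrFun₂ h2 i j
    simp only [restrictBlock_of_eq rfl, restrictBlock_of_eq hij] at h1 h2
    simp only [Option.some.injEq, exists_eq_left', eq_iff_iff, exists_and_left] at h1 h2
    exact ⟨h1, h2⟩
  · have h := hu i j (Ne.symm hij)
    have h' := hu' i j (Ne.symm hij)
    have key : ∀ i, c (u i) = c (u' i) := fun i => by
      have := congrFun (hcol (κ i)).2.2 i
      simpa [restrictBlock_of_eq] using this
    exact ⟨iff_of_false (hD.ne_of_lt h) (hD.ne_of_lt h'), hc _ _ _ _ h h' (key i) (key j)⟩

/-- One more round. Let `r` be the separation needed for `q` rounds, and call a colour of single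
vertices rich if `|ι| + 1` vertices of that colour are pairwise at distance more than `2r`; a poor
colour class is covered by the `2r`-balls around `|ι| + 1` centres. The new colour of a block
records the old colour of the block, the old colours of its extensions by vertices within `5r`, and
which of the centres are within `3r` of the block.

A vertex `z` within `5r` of a block is answered inside the corresponding block. If `z` is far from
all blocks and its colour is rich, some vertex of that colour is far from the other tuple; if its
colour is poor, then `z` itself is far from the other tuple. -/
theorem exists_determinesBackForth_succ {q : ℕ} {ι K : Type} [Finite ι] [Finite K] :
    ∃ (K' : Type) (_ : Finite K'), ∀ (V : Type*) [Nonempty V] (G : SimpleGraph V)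
      (D : V → V → ℕ∞) (r : ℕ) (col : (Option ι → Option V) → K), IsExtDist D →
      G.DeterminesBackForth D q r col →
      ∃ col' : (ι → Option V) → K', G.DeterminesBackForth D (q + 1) (6 * r) col' := by
  have := Fintype.ofFinite ι
  refine ⟨K × Set K × Set (K × Fin (Fintype.card ι + 1)), inferInstance,
    fun V _ G D r col hD hcol => ?_⟩
  let single : V → K := fun z => col (Option.elim' (some z) fun _ => none)
  choose w hw using fun k : K =>
    show ∃ w : Fin (Fintype.card ι + 1) → V,
      ((∀ i, single (w i) = k) ∧ ∀ i j, i < j → ((r + r : ℕ) : ℕ∞) < D (w i) (w j)) ∨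
        ∀ u, single u = k → ∃ i, ¬ ((r + r : ℕ) : ℕ∞) < D (w i) u by
      rcases exists_pairwise_or_cover (fun a b => ((r + r : ℕ) : ℕ∞) < D a b)
        {u | single u = k} (Fintype.card ι + 1) with ⟨w, h, h'⟩ | ⟨w, h⟩
      exacts [⟨w, .inl ⟨h, h'⟩⟩, ⟨w, .inr h⟩]
  let col' : (ι → Option V) → K × Set K × Set (K × Fin (Fintype.card ι + 1)) := fun s =>
    (col (Option.elim' none s),
      {k | ∃ z, (∃ i a, s i = some a ∧ D a z ≤ (5 * r : ℕ)) ∧ col (Option.elim' (some z) s) = k},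
      {x | ∃ i a, s i = some a ∧ D a (w x.1 x.2) ≤ (3 * r : ℕ)})
  have forth : ∀ (β : Type) (κ : ι → β) (u u' : ι → V), Separated D (6 * r) κ u →
      Separated D (6 * r) κ u' →
      (∀ b, col' (restrictBlock κ b u) = col' (restrictBlock κ b u')) →
      ∀ z, ∃ z', G.BackForth q (Option.elim' z u) (Option.elim' z' u') := by
    intro β κ u u' hu hu' h z
    simp only [col', Prod.mk.injEq] at h
    have apart : ∀ (x : V) (u : ι → V), Separated D (6 * r) κ u → ∀ i, D (u i) x ≤ (5 * r : ℕ) →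
        ∀ j, κ j ≠ κ i → (r : ℕ∞) < D (u j) x := fun x u hu i hi j hj => by
      rw [hD.symm]
      exact hD.lt_right (by rw [show 5 * r + r = 6 * r by ring]; exact hu i j hj.symm) hi
    by_cases hz : ∃ i, D (u i) z ≤ (5 * r : ℕ)
    · obtain ⟨i, hi⟩ := hz
      obtain ⟨z', ⟨i', a, ha, hz'⟩, hcol'⟩ := (Set.ext_iff.1 (h (κ i)).2.1 _).1
        ⟨z, ⟨i, u i, restrictBlock_of_eq rfl, hi⟩, rfl⟩
      obtain ⟨hi', rfl⟩ := restrictBlock_eq_some.1 ha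
      refine ⟨z', hcol β (Option.elim' (κ i) κ) _ _
        (hu.elim' hD (by omega) (apart z u hu i hi))
        (hu'.elim' hD (by omega) (hi' ▸ apart z' u' hu' i' hz')) fun b => ?_⟩
      by_cases hb : κ i = b
      · subst hb
        rw [restrictBlock_elim'_same, restrictBlock_elim'_same, hcol']
      · rw [restrictBlock_elim'_ne hb, restrictBlock_elim'_ne hb, (h b).1]
    · push Not at hz
      obtain ⟨z', hz', hfar⟩ : ∃ z', single z = single z' ∧ ∀ i, (r : ℕ∞) < D (u' i) z' := by
        rcases hw (single z) with ⟨hcolor, hpair⟩ | hcover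
        · obtain ⟨k, hk⟩ := hD.exists_far (Nat.lt_succ_self _) hpair u'
          exact ⟨_, (hcolor k).symm, hk⟩
        · obtain ⟨k, hk⟩ := hcover z rfl
          have hk := not_lt.1 hk
          refine ⟨z, rfl, fun i => ?_⟩
          by_contra! hi
          obtain ⟨i', a, ha, hi'⟩ := (Set.ext_iff.1 (h (κ i)).2.2 (single z, k)).2
            ⟨i, u' i, restrictBlock_of_eq rfl, by
              by_contra! hlt
              refine absurd (hD.lt_right (a := w (single z) k) (b := z) (c := u' i) (r := r + r)
                (s := r) ?_ hk) (not_lt.2 (by rw [hD.symm]; exact hi))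
              rw [hD.symm, show r + r + r = 3 * r by ring]
              exact hlt⟩
          obtain ⟨-, rfl⟩ := restrictBlock_eq_some.1 ha
          refine absurd (hD.lt_right (s := r + r) ?_ hi') (not_lt.2 hk)
          rw [show 3 * r + (r + r) = 5 * r by ring]
          exact hz i'
      refine ⟨z', hcol (Option β) (Option.elim' none (some ∘ κ)) _ _ ?_ ?_ fun b => ?_⟩
      · refine Separated.elim' hD (s := 6 * r) (fun i j hij => hu i j fun h => hij (by simp [h]))
          (by omega) fun i _ => lt_of_le_of_lt ?_ (hz i)
        exact_mod_cast (by omega : r ≤ 5 * r)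
      · exact Separated.elim' hD (s := 6 * r) (fun i j hij => hu' i j fun h => hij (by simp [h]))
          (by omega) fun i _ => hfar i
      · cases b with
        | none => rw [restrictBlock_new_none, restrictBlock_new_none]; exact hz'
        | some b => rw [restrictBlock_new_some, restrictBlock_new_some, (h b).1]
  refine ⟨col', fun β κ u u' hu hu' h => ⟨forth β κ u u' hu hu' h, fun z' => ?_⟩⟩
  obtain ⟨z, hz⟩ := forth β κ u' u hu' hu (fun b => (h b).symm) z'
  exact ⟨z, hz.symm⟩

/-- The separation `r * 6 ^ q` depends neither on the number of variables nor on the number of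
colours. -/
theorem exists_determinesBackForth (q : ℕ) (ι C : Type) [Finite ι] [Finite C] :
    ∃ (K : Type) (_ : Finite K), ∀ (V : Type*) [Nonempty V] (G : SimpleGraph V)
      (D : V → V → ℕ∞) (r : ℕ) (c : V → C), IsExtDist D → G.DeterminesFarAdj D r c →
      ∃ col : (ι → Option V) → K, G.DeterminesBackForth D q (r * 6 ^ q) col := by
  induction q generalizing ι with
  | zero =>
    obtain ⟨K, hK, H⟩ := exists_determinesBackForth_zero ι C
    refine ⟨K, hK, fun V _ G D r c hD hc => ?_⟩
    rw [pow_zero, mul_one]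
    exact H V G D r c hD hc
  | succ q ih =>
    obtain ⟨K, hK, H⟩ := ih (Option ι)
    obtain ⟨K', hK', H'⟩ := exists_determinesBackForth_succ (q := q) (ι := ι) (K := K)
    refine ⟨K', hK', fun V _ G D r c hD hc => ?_⟩
    obtain ⟨col, hcol⟩ := H V G D r c hD hc
    rw [show r * 6 ^ (q + 1) = 6 * (r * 6 ^ q) by ring]
    exact H' V G D _ col hD hcol

/-! ### Partition flips -/

/-- `G.IsCodedFlip part b H`: on distinct vertices, `H` arises from `G` by complementing the
adjacency exactly between those classes of `part` that are related by `b`. -/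
def IsCodedFlip {V I : Type*} (G : SimpleGraph V) (part : V → I) (b : I → I → Prop)
    (H : SimpleGraph V) : Prop :=
  ∀ u v, u ≠ v → (H.Adj u v ↔ ¬ (G.Adj u v ↔ b (part u) (part v)))

theorem IsCodedFlip.unique {V I : Type*} {G H H' : SimpleGraph V} {part : V → I}
    {b : I → I → Prop} (h : G.IsCodedFlip part b H) (h' : G.IsCodedFlip part b H') : H = H' := by
  ext u v
  by_cases huv : u = v
  · simp [huv]
  · rw [h u v huv, h' u v huv]

theorem IsPartitionFlip.exists_code {V I : Type*} {G H : SimpleGraph V} {P : Set (Set V)}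
    {part : V → I} (hpart : ∀ A ∈ P, ∃ a, ∀ v, v ∈ A ↔ part v = a) (h : G.IsPartitionFlip P H) :
    ∃ b, G.IsCodedFlip part b H := by
  induction h with
  | refl => exact ⟨fun _ _ => False, fun u v _ => by simp⟩
  | @step H A B _ hA hB ih =>
    obtain ⟨b, ih⟩ := ih
    obtain ⟨x, hx⟩ := hpart A hA
    obtain ⟨y, hy⟩ := hpart B hB
    refine ⟨fun i j => ¬ (b i j ↔ (i = x ∧ j = y ∨ j = x ∧ i = y)), fun u v huv => ?_⟩
    have := ih u v huv
    simp only [flip, symmDiff_def, sup_adj, sdiff_adj, fromRel_adj, hx, hy, this]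
    tauto

/-- The parts of a partition into at most `p` parts are fibres of a map to `Fin p`. -/
theorem exists_part_of_isPartition {V : Type*} {P : Set (Set V)} (hP : Setoid.IsPartition P)
    {p : ℕ} (hp : P.encard ≤ p) :
    ∃ part : V → Fin p, ∀ A ∈ P, ∃ a, ∀ v, v ∈ A ↔ part v = a := by
  have hfin : P.Finite := Set.finite_of_encard_le_coe hp
  have := hfin.fintype
  have hcard : Fintype.card P ≤ p := by
    rw [Set.encard_eq_coe_toFinset_card, Set.toFinset_card] at hp
    exact_mod_cast hp
  let e : P ↪ Fin p := (Fintype.equivFin P).toEmbedding.trans (Fin.castLEEmb hcard)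
  choose block hblock huniq using hP.2
  refine ⟨fun v => e ⟨block v, (hblock v).1⟩, fun A hA => ⟨e ⟨A, hA⟩, fun v => ?_⟩⟩
  rw [e.injective.eq_iff, Subtype.mk.injEq]
  exact ⟨fun hv => (huniq v A ⟨hA, hv⟩).symm, fun h => h ▸ (hblock v).2⟩

theorem isExtDist_partitionDist {V : Type*} (G : SimpleGraph V) (P : Set (Set V)) :
    IsExtDist (G.partitionDist P) where
  self a := by simp [partitionDist]
  symm a b := by simp only [partitionDist, edist_comm]
  triangle a b c := iSup₂_le fun H hH => H.edist_triangle.trans <| add_le_add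
    (le_iSup₂_of_le H hH le_rfl) (le_iSup₂_of_le H hH le_rfl)

theorem isExtDist_edist {V : Type*} (G : SimpleGraph V) : IsExtDist G.edist where
  self _ := edist_self
  symm _ _ := edist_comm
  triangle _ _ _ := G.edist_triangle

theorem not_adj_of_one_lt_edist {V : Type*} {G : SimpleGraph V} {u v : V}
    (h : ((1 : ℕ) : ℕ∞) < G.edist u v) : ¬ G.Adj u v := fun hadj => by
  rw [edist_eq_one_iff_adj.2 hadj] at h
  exact lt_irrefl _ h

/-! ### Adjacency of vertices that are far in the partition metric -/

/-- The vertices `w` are pairwise at distance more than `2` in one graph `H`, which is the flip of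
`G` coded by `b`. -/
structure IsSpread {V I : Type*} (G : SimpleGraph V) (part : V → I) (b : I → I → Prop)
    (H : SimpleGraph V) (w : Fin 3 → V) : Prop where
  coded : G.IsCodedFlip part b H
  far : ∀ i j, i ≠ j → ((2 : ℕ) : ℕ∞) < H.edist (w i) (w j)

/-- A vertex lies in the closed `H`-neighbourhood of at most one of the three vertices. -/
theorem IsSpread.exists_exception {V I : Type*} {G H : SimpleGraph V} {part : V → I}
    {b : I → I → Prop} {w : Fin 3 → V} (h : G.IsSpread part b H w) (v : V) :
    ∃ i₀, ∀ i, i ≠ i₀ → w i ≠ v ∧ (G.Adj (w i) v ↔ b (part (w i)) (part v)) ∧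
      (G.Adj v (w i) ↔ b (part v) (part (w i))) := by
  have key : ∃ i₀, ∀ i, i ≠ i₀ → ((1 : ℕ) : ℕ∞) < H.edist (w i) v := by
    by_cases hne : ∃ i₀, H.edist (w i₀) v ≤ (1 : ℕ)
    · obtain ⟨i₀, h₀⟩ := hne
      refine ⟨i₀, fun i hi => ?_⟩
      rw [H.isExtDist_edist.symm]
      exact H.isExtDist_edist.lt_right (h.far i₀ i hi.symm) h₀
    · push Not at hne
      exact ⟨0, fun i _ => hne i⟩
  obtain ⟨i₀, hi₀⟩ := key
  refine ⟨i₀, fun i hi => ?_⟩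
  have hne := H.isExtDist_edist.ne_of_lt (hi₀ i hi)
  have hadj := not_adj_of_one_lt_edist (hi₀ i hi)
  have hadj' := mt Adj.symm hadj
  rw [h.coded _ _ hne] at hadj
  rw [h.coded _ _ hne.symm] at hadj'
  exact ⟨hne, not_not.1 hadj, not_not.1 hadj'⟩

/-- The class `a` of `part` contains three vertices at pairwise distance more than `2` in a common
`P`-flip of `G`. -/
def IsLargeClass {V I : Type*} (G : SimpleGraph V) (part : V → I) (a : I) : Prop :=
  ∃ b H w, G.IsSpread part b H w ∧ ∀ i, part (w i) = a

/-- Let `w` and `x` be spread triples in the classes `a` and `a'`. Apart from a few exceptions, the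
pairs `u x`, `w x` and `w v` with `u` in `a` and `v` in `a'` have one and the same adjacency `β` in
`G`. If the adjacency of `u` and `v` differs from `β`, then every flip in which `u` and `v` are not
adjacent turns some `u x w v` into a path. -/
theorem IsLargeClass.exists_adj_iff {V I : Type*} {G : SimpleGraph V} {P : Set (Set V)}
    {part : V → I} (hpart : ∀ A ∈ P, ∃ a, ∀ v, v ∈ A ↔ part v = a) {a a' : I}
    (ha : G.IsLargeClass part a) (ha' : G.IsLargeClass part a') :
    ∃ β : Prop, ∀ u v, part u = a → part v = a' → ((3 : ℕ) : ℕ∞) < G.partitionDist P u v →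
      (G.Adj u v ↔ β) := by
  obtain ⟨b₁, H₁, w, hw, hwa⟩ := ha
  obtain ⟨b₂, H₂, x, hx, hxa⟩ := ha'
  have third : ∀ i j : Fin 3, ∃ k, k ≠ i ∧ k ≠ j := by decide
  refine ⟨b₁ a a', fun u v hu hv huv => ?_⟩
  obtain ⟨j₀, hj₀⟩ := hx.exists_exception u
  -- Of the nine pairs `w i`, `x j`, each triple excludes at most three, so some pair is regular for
  -- both triples.
  have hbits : b₁ a a' ↔ b₂ a a' := by
    choose f hf using fun i => hx.exists_exception (w i)
    choose g hg using fun j => hw.exists_exception (x j)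
    obtain ⟨i, j, hi, hj⟩ : ∃ i j, i ≠ g j ∧ j ≠ f i := by
      clear * - f g
      revert f g
      decide
    have h₁ := (hg j i hi).2.1
    have h₂ := (hf i j hj).2.2
    rw [hwa, hxa] at h₁ h₂
    exact h₁.symm.trans h₂
  obtain ⟨H, hH, hlt⟩ : ∃ H, G.IsPartitionFlip P H ∧ ((3 : ℕ) : ℕ∞) < H.edist u v := by
    simpa [partitionDist, lt_iSup_iff] using huv
  obtain ⟨b, hb⟩ := hH.exists_code hpart
  obtain ⟨j, hj, -⟩ := third j₀ j₀
  obtain ⟨i₀, hi₀⟩ := hw.exists_exception (x j)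
  obtain ⟨i₁, hi₁⟩ := hw.exists_exception v
  obtain ⟨i, hi, hi'⟩ := third i₀ i₁
  obtain ⟨hne₁, -, h₁⟩ := hj₀ j hj
  obtain ⟨hne₂, h₂, -⟩ := hi₀ i hi
  obtain ⟨hne₃, h₃, -⟩ := hi₁ i hi'
  have huv_ne : u ≠ v := H.isExtDist_edist.ne_of_lt hlt
  have huv_adj : ¬ H.Adj u v :=
    not_adj_of_one_lt_edist (lt_of_le_of_lt (by norm_num) hlt)
  by_contra hβ
  refine absurd hlt (not_lt.2 ?_)
  rw [hb u v huv_ne, hu, hv] at huv_adj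
  rw [hu, hxa] at h₁
  rw [hwa, hxa] at h₂
  rw [hwa, hv] at h₃
  have hdiff : ¬ (b₁ a a' ↔ b a a') := fun h => hβ ((not_not.1 huv_adj).trans h.symm)
  have e₁ : H.Adj u (x j) := by
    rw [hb _ _ hne₁.symm, hu, hxa]
    exact fun h => hdiff (hbits.trans (h₁.symm.trans h))
  have e₂ : H.Adj (x j) (w i) := by
    rw [H.adj_comm, hb _ _ hne₂, hwa, hxa]
    exact fun h => hdiff (h₂.symm.trans h)
  have e₃ : H.Adj (w i) v := by
    rw [hb _ _ hne₃, hwa, hv]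
    exact fun h => hdiff (h₃.symm.trans h)
  exact H.edist_le (.cons e₁ (.cons e₂ (.cons e₃ .nil)))

/-- By Ramsey's theorem, a class with many vertices at pairwise partition distance more than `2`
has three of them separated by the same flip. -/
theorem exists_cover_of_not_isLargeClass (p : ℕ) :
    ∃ N : ℕ, ∀ (V : Type*) [Nonempty V] (G : SimpleGraph V) (P : Set (Set V)) (part : V → Fin p),
      (∀ A ∈ P, ∃ a, ∀ v, v ∈ A ↔ part v = a) → ∀ a, ¬ G.IsLargeClass part a →
      ∃ w : Fin N → V, ∀ u, part u = a → ∃ i, G.partitionDist P (w i) u ≤ (2 : ℕ) := by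
  obtain ⟨N, hN⟩ := exists_monochromatic_triangle (Fin p → Fin p → Prop)
  refine ⟨N, fun V _ G P part hpart a ha => ?_⟩
  rcases exists_pairwise_or_cover (fun u v => ((2 : ℕ) : ℕ∞) < G.partitionDist P u v)
    {u | part u = a} N with ⟨w, hwa, hw⟩ | ⟨w, hw⟩
  · refine absurd ?_ ha
    have hcol : ∀ i j, ∃ b : Fin p → Fin p → Prop, i < j →
        ∃ H, G.IsCodedFlip part b H ∧ ((2 : ℕ) : ℕ∞) < H.edist (w i) (w j) := fun i j => by
      by_cases hij : i < j
      · have := hw i j hij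
        obtain ⟨H, hH, hlt⟩ : ∃ H, G.IsPartitionFlip P H ∧ ((2 : ℕ) : ℕ∞) < H.edist (w i) (w j) := by
          simpa [partitionDist, lt_iSup_iff] using this
        obtain ⟨b, hb⟩ := hH.exists_code hpart
        exact ⟨b, fun _ => ⟨H, hb, hlt⟩⟩
      · exact ⟨fun _ _ => False, fun h => absurd h hij⟩
    choose col hcol using hcol
    obtain ⟨i, j, k, hij, hjk, h₁, h₂⟩ := hN col
    obtain ⟨H, hH, d₁⟩ := hcol i j hij
    obtain ⟨H', hH', d₂⟩ := hcol i k (hij.trans hjk)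
    obtain ⟨H'', hH'', d₃⟩ := hcol j k hjk
    obtain rfl := hH.unique (h₁ ▸ hH')
    obtain rfl := hH.unique (h₂ ▸ hH'')
    refine ⟨col i j, H, ![w i, w j, w k], ⟨hH, ?_⟩, ?_⟩
    · intro s t hst
      have d₁' := d₁
      have d₂' := d₂
      have d₃' := d₃
      rw [edist_comm] at d₁' d₂' d₃'
      fin_cases s <;> fin_cases t <;> first | exact absurd rfl hst | assumption
    · intro s
      fin_cases s
      exacts [hwa i, hwa j, hwa k]
  · exact ⟨w, fun u hu => (hw u hu).imp fun _ => not_lt.1⟩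

/-- A vertex is coloured by its class, a centre close to it if its class is not large, and, for
every centre `w` that is far from it, the code of a flip in which it is far from `w`. Whatever is
close to `w` in the partition metric is close to `w` in that flip, so the code determines the
adjacency to it. -/
theorem exists_determinesFarAdj (p : ℕ) :
    ∃ (C : Type) (_ : Finite C), ∀ (V : Type*) [Nonempty V] (G : SimpleGraph V) (P : Set (Set V)),
      Setoid.IsPartition P → P.encard ≤ p →
      ∃ c : V → C, G.DeterminesFarAdj (G.partitionDist P) 5 c := by
  obtain ⟨N, hN⟩ := exists_cover_of_not_isLargeClass p
  refine ⟨Fin p × Option (Fin N) × (Fin p → Fin N → Fin p → Fin p → Prop), inferInstance,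
    fun V _ G P hP hp => ?_⟩
  obtain ⟨part, hpart⟩ := exists_part_of_isPartition hP hp
  have hD := G.isExtDist_partitionDist P
  have hcover : ∀ a, ∃ w : Fin N → V, ¬ G.IsLargeClass part a →
      ∀ u, part u = a → ∃ i, G.partitionDist P (w i) u ≤ (2 : ℕ) := fun a => by
    by_cases ha : G.IsLargeClass part a
    · obtain ⟨w⟩ : Nonempty (Fin N → V) := inferInstance
      exact ⟨w, fun h => absurd ha h⟩
    · exact (hN V G P part hpart a ha).imp fun w hw _ => hw
  choose w hw using hcover
  have hindex : ∀ u, ∃ o : Option (Fin N), ¬ G.IsLargeClass part (part u) →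
      ∃ i, o = some i ∧ G.partitionDist P (w (part u) i) u ≤ (2 : ℕ) := fun u => by
    by_cases ha : G.IsLargeClass part (part u)
    · exact ⟨none, fun h => absurd ha h⟩
    · obtain ⟨i, hi⟩ := hw (part u) ha u rfl
      exact ⟨some i, fun _ => ⟨i, rfl, hi⟩⟩
  choose index hindex using hindex
  have hcode : ∀ v a i, ∃ b : Fin p → Fin p → Prop,
      ((3 : ℕ) : ℕ∞) < G.partitionDist P (w a i) v →
      ∃ H, G.IsPartitionFlip P H ∧ G.IsCodedFlip part b H ∧
        ((3 : ℕ) : ℕ∞) < H.edist (w a i) v := fun v a i => by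
    by_cases h : ((3 : ℕ) : ℕ∞) < G.partitionDist P (w a i) v
    · obtain ⟨H, hH, hlt⟩ : ∃ H, G.IsPartitionFlip P H ∧ ((3 : ℕ) : ℕ∞) < H.edist (w a i) v := by
        simpa [partitionDist, lt_iSup_iff] using h
      obtain ⟨b, hb⟩ := hH.exists_code hpart
      exact ⟨b, fun _ => ⟨H, hH, hb, hlt⟩⟩
    · exact ⟨fun _ _ => False, fun h' => absurd h' h⟩
  choose code hcode using hcode
  have small : ∀ u v i, ((5 : ℕ) : ℕ∞) < G.partitionDist P u v →
      G.partitionDist P (w (part u) i) u ≤ (2 : ℕ) →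
      (G.Adj u v ↔ code v (part u) i (part u) (part v)) := fun u v i huv hi => by
    obtain ⟨H, hH, hb, hlt⟩ := hcode v (part u) i
      (hD.lt_right (r := 2) huv (by rw [hD.symm]; exact hi))
    have hle : H.edist (w (part u) i) u ≤ (2 : ℕ) := le_trans (le_iSup₂_of_le H hH le_rfl) hi
    have hadj := not_adj_of_one_lt_edist (H.isExtDist_edist.lt_right (s := 1) hlt hle)
    rw [hb u v (hD.ne_of_lt huv)] at hadj
    exact not_not.1 hadj
  have small' : ∀ u u' v v', ¬ G.IsLargeClass part (part u) →
      ((5 : ℕ) : ℕ∞) < G.partitionDist P u v → ((5 : ℕ) : ℕ∞) < G.partitionDist P u' v' →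
      part u = part u' → part v = part v' → index u = index u' → code v = code v' →
      (G.Adj u v ↔ G.Adj u' v') := fun u u' v v' hl huv huv' hu hv hi hc => by
    obtain ⟨i, hui, hd⟩ := hindex u hl
    obtain ⟨i', hui', hd'⟩ := hindex u' (hu ▸ hl)
    obtain rfl : i = i' := Option.some.inj (hui.symm.trans (hi.trans hui'))
    rw [small u v i huv hd, small u' v' i huv' hd', hu, hv, hc]
  refine ⟨fun v => (part v, index v, code v), fun u u' v v' huv huv' hu hv => ?_⟩
  simp only [Prod.mk.injEq] at hu hv
  obtain ⟨hu₁, hu₂, hu₃⟩ := hu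
  obtain ⟨hv₁, hv₂, hv₃⟩ := hv
  by_cases hlu : G.IsLargeClass part (part u)
  · by_cases hlv : G.IsLargeClass part (part v)
    · obtain ⟨β, hβ⟩ := hlu.exists_adj_iff hpart hlv
      have hle : ((3 : ℕ) : ℕ∞) ≤ ((5 : ℕ) : ℕ∞) := by norm_num
      rw [hβ u v rfl rfl (hle.trans_lt huv), hβ u' v' hu₁.symm hv₁.symm (hle.trans_lt huv')]
    · rw [G.adj_comm u v, G.adj_comm u' v']
      rw [hD.symm] at huv huv'
      exact small' v v' u u' hlv huv huv' hv₁ hu₁ hv₂ hu₃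
  · exact small' u u' v v' hlu huv huv' hu₁ hv₁ hu₂ hv₃

/-! ### Formulas on separated tuples -/

/-- For `φ` of quantifier rank `q`, the two colourings are the colours of the blocks `x̄` and `ȳ` in
the `q`-round game on the tuple `(x̄, ȳ)`. -/
theorem exists_colorings (q m n p : ℕ) :
    ∃ ℓ : ℕ, ∀ (φ : Language.graph.Formula (Fin m ⊕ Fin n)), φ.quantifierRank = q →
      ∀ (V : Type*) (G : SimpleGraph V) (P : Set (Set V)), Setoid.IsPartition P → P.encard ≤ p →
      ∃ (col₁ : (Fin m → V) → Fin ℓ) (col₂ : (Fin n → V) → Fin ℓ),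
        ∀ (u u' : Fin m → V) (v v' : Fin n → V),
          ((5 * 6 ^ q : ℕ) : ℕ∞) < G.partitionTupleDist P u v →
          ((5 * 6 ^ q : ℕ) : ℕ∞) < G.partitionTupleDist P u' v' →
          col₁ u = col₁ u' → col₂ v = col₂ v' → (G.Satisfies φ u v ↔ G.Satisfies φ u' v') := by
  obtain ⟨C, hC, hadj⟩ := exists_determinesFarAdj p
  obtain ⟨K, hK, hgame⟩ := exists_determinesBackForth q (Fin m ⊕ Fin n) C
  obtain ⟨ℓ, ⟨e⟩⟩ := Finite.exists_equiv_fin K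
  -- The additional colour serves the empty graph, for which `K` may be empty.
  refine ⟨ℓ + 1, fun φ hφ V G P hP hp => ?_⟩
  rcases isEmpty_or_nonempty V with hV | hV
  · refine ⟨fun _ => 0, fun _ => 0, fun u u' v v' _ _ _ _ => ?_⟩
    rw [Subsingleton.elim u u', Subsingleton.elim v v']
  obtain ⟨c, hc⟩ := hadj V G P hP hp
  have hD := G.isExtDist_partitionDist P
  obtain ⟨col, hcol⟩ := hgame V G _ 5 c hD hc
  refine ⟨fun u => (e (col (Sum.elim (some ∘ u) fun _ => none))).castSucc,
    fun v => (e (col (Sum.elim (fun _ => none) (some ∘ v)))).castSucc,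
    fun u u' v v' h h' hu hv => ?_⟩
  have hu := e.injective (Fin.castSucc_injective _ hu)
  have hv := e.injective (Fin.castSucc_injective _ hv)
  have sep : ∀ (u : Fin m → V) (v : Fin n → V),
      ((5 * 6 ^ q : ℕ) : ℕ∞) < G.partitionTupleDist P u v →
      Separated (G.partitionDist P) (5 * 6 ^ q) Sum.isLeft (Sum.elim u v) := fun u v h => by
    have key : ∀ i j, ((5 * 6 ^ q : ℕ) : ℕ∞) < G.partitionDist P (u i) (v j) :=
      fun i j => h.trans_le <|
        iInf₂_le (f := fun i j => G.partitionDist P (u i) (v j)) i j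
    rintro (i | j) (i' | j') hij
    · exact absurd rfl hij
    · exact key i j'
    · rw [hD.symm]
      exact key i' j
    · exact absurd rfl hij
  have left : ∀ (u : Fin m → V) (v : Fin n → V),
      restrictBlock Sum.isLeft true (Sum.elim u v) = Sum.elim (some ∘ u) fun _ => none :=
    fun u v => by ext x a; cases x <;> simp [restrictBlock_eq_some]
  have right : ∀ (u : Fin m → V) (v : Fin n → V),
      restrictBlock Sum.isLeft false (Sum.elim u v) = Sum.elim (fun _ => none) (some ∘ v) :=
    fun u v => by ext x a; cases x <;> simp [restrictBlock_eq_some]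
  have hbf := hcol Bool Sum.isLeft (Sum.elim u v) (Sum.elim u' v') (sep u v h) (sep u' v' h')
    fun b => by
      cases b
      · rw [right, right, hv]
      · rw [left, left, hu]
  -- The variables of a formula, seen as a bounded formula, are indexed by `(Fin m ⊕ Fin n) ⊕ Fin 0`.
  have hbf := hbf.comp (Sum.elim id finZeroElim : (Fin m ⊕ Fin n) ⊕ Fin 0 → Fin m ⊕ Fin n)
  refine BackForth.realize_iff φ hφ.le ?_
  convert hbf using 1
  all_goals
    funext x
    rcases x with x | x
    · rfl
    · exact x.elim0

end SimpleGraph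

theorem mainTheorem8 :
    ∃ (ρ : ℕ → ℕ) (ℓ : ℕ → ℕ → ℕ → ℕ → ℕ),
      ∀ (p m n : ℕ) (φ : FirstOrder.Language.graph.Formula (Fin m ⊕ Fin n))
        (V : Type*) (G : SimpleGraph V) (P : Set (Set V)),
        Setoid.IsPartition P → P.encard ≤ p →
        ∃ (col₁ : (Fin m → V) → Fin (ℓ φ.quantifierRank m n p))
          (col₂ : (Fin n → V) → Fin (ℓ φ.quantifierRank m n p)),
          ∀ (u u' : Fin m → V) (v v' : Fin n → V),
            (ρ φ.quantifierRank : ℕ∞) < G.partitionTupleDist P u v →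
            (ρ φ.quantifierRank : ℕ∞) < G.partitionTupleDist P u' v' →
            col₁ u = col₁ u' → col₂ v = col₂ v' →
            (G.Satisfies φ u v ↔ G.Satisfies φ u' v') := by
  choose ℓ hℓ using SimpleGraph.exists_colorings
  exact ⟨fun q => 5 * 6 ^ q, ℓ, fun p m n φ => hℓ _ m n p φ rfl⟩
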